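/- **Theorem 3.1 (Curie–Weiss application).** Let $J,B\in\mathbb{R}$ and let $\sigma_1=\begin{pmatrix}0&1\\1&0\end{pmatrix}$, $\sigma_3=\begin{pmatrix}1&0\\0&-1\end{pmatrix}$ be the Pauli matrices. For $N\in\mathbb{N}=\{1,2,3,\dots\}$ let $$h^{CW}_{1/N}=\frac1N\Big(-\frac{J}{2N}\sum_{i,j=1}^N\sigma_3(i)\sigma_3(j)-B\sum_{j=1}^N\sigma_1(j)\Big)$$ be the quantum Curie–Weiss Hamiltonian on $(\mathbb{C}^2)^{\otimes N}$, where $\sigma_k(j)=I_2\otimes\cdots\otimes\sigma_k\otimes\cdots\otimes I_2$ with $\sigma_k$ in the $j$-th slot. It maps the subspace $\mathrm{Sym}^N(\mathbb{C}^2)\subset(\mathbb{C}^2)^{\otimes N}$ of permutation-invariant vectors to itself, and $h^{CW}_{1/N}|_{\mathrm{Sym}^N(\mathbb{C}^2)}$ denotes its restriction to this subspace. Let $$h^{CW}_0(x,y,z)=-\Big(\frac J2 z^2+Bx\Big),\qquad (x,y,z)\in B^3,$$ be the classical Curie–Weiss Hamiltonian on the closed unit ball $B^3\subset\mathbb{R}^3$,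 whose boundary is the unit sphere $S^2$. For $f\in C(S^2)$ let $$Q'_{1/N}(f)=\frac{N+1}{4\pi}\int_{S^2}f(\Omega)\,|\Omega\rangle\langle\Omega|_N\,d\Omega\in B(\mathrm{Sym}^N(\mathbb{C}^2)),$$ where $d\Omega$ is the rotation-invariant measure on $S^2$ of total mass $4\pi$, $|\Omega\rangle_N=|\Omega\rangle_1^{\otimes N}$, and $|\Omega\rangle_1=\cos\frac{\theta}{2}\,|{\uparrow}\rangle+e^{i\phi}\sin\frac{\theta}{2}\,|{\downarrow}\rangle$ for the point $\Omega=(\sin\theta\cos\phi,\sin\theta\sin\phi,\cos\theta)$ with polar angles $\theta,\phi$, with $\sigma_3|{\uparrow}\rangle=|{\uparrow}\rangle$ and $\sigma_3|{\downarrow}\rangle=-|{\downarrow}\rangle$ the standard basis of $\mathbb{C}^2$. Then $$\lim_{N\to\infty}\Big\|h^{CW}_{1/N}|_{\mathrm{Sym}^N(\mathbb{C}^2)}-Q'_{1/N}\big(h^{CW}_0|_{S^2}\big)\Big\|_N=0,$$ where $\|\cdot\|_N$ is the operator norm on $B(\mathrm{Sym}^N(\mathbb{C}^2))$. -/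

import Mathlib

open MeasureTheory Filter Topology

noncomputable section

namespace CurieWeiss

/-! ### The space of `N` spins and its symmetric subspace -/

/-- The single-site Hilbert space `ℂ²`; the basis vectors with index `0` and `1` are the
spin-up and the spin-down vector. -/
abbrev Qubit : Type := EuclideanSpace ℂ (Fin 2)

/-- The Hilbert space `ℂ² ⊗ ⋯ ⊗ ℂ²` (`N` factors), written in its orthonormal product basis
`e_{s 0} ⊗ ⋯ ⊗ e_{s (N-1)}`, which is indexed by the maps `s : Fin N → Fin 2`. -/
abbrev SpinSpace (N : ℕ) : Type := EuclideanSpace ℂ (Fin N → Fin 2)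

/-- The elementary tensor `v 0 ⊗ ⋯ ⊗ v (N-1)`. -/
def elemTensor {N : ℕ} (v : Fin N → Qubit) : SpinSpace N :=
  WithLp.toLp 2 fun s => ∏ i, v i (s i)

/-- The tensor product `A 0 ⊗ ⋯ ⊗ A (N-1)` of `2 × 2` matrices, in the product basis. -/
def tensorMatrix {N : ℕ} (A : Fin N → Matrix (Fin 2) (Fin 2) ℂ) :
    Matrix (Fin N → Fin 2) (Fin N → Fin 2) ℂ :=
  Matrix.of fun s t => ∏ i, A i (s i) (t i)

/-- The tensor product `A 0 ⊗ ⋯ ⊗ A (N-1)` as an operator on `ℂ² ⊗ ⋯ ⊗ ℂ²`. -/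
def tensorOp {N : ℕ} (A : Fin N → Matrix (Fin 2) (Fin 2) ℂ) : SpinSpace N →L[ℂ] SpinSpace N :=
  Matrix.toEuclideanCLM (𝕜 := ℂ) (tensorMatrix A)

lemma tensorOp_apply {N : ℕ} (A : Fin N → Matrix (Fin 2) (Fin 2) ℂ) (ψ : SpinSpace N)
    (s : Fin N → Fin 2) : tensorOp A ψ s = ∑ t, (∏ i, A i (s i) (t i)) * ψ t := by
  rw [tensorOp, Matrix.ofLp_toEuclideanCLM]
  simp [tensorMatrix, Matrix.mulVec, dotProduct]

/-- The scalar product of two elementary tensors is the product of the scalar products. -/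
lemma inner_elemTensor {N : ℕ} (v w : Fin N → Qubit) :
    inner ℂ (elemTensor v) (elemTensor w) = ∏ i, inner ℂ (v i) (w i) := by
  simp only [elemTensor, PiLp.inner_apply, RCLike.inner_apply, map_prod,
    ← Finset.prod_mul_distrib]
  exact (Fintype.prod_sum fun i a => w i a * (starRingEnd ℂ) (v i a)).symm

/-- `(A 0 ⊗ ⋯) (v 0 ⊗ ⋯) = A 0 v 0 ⊗ ⋯`. -/
lemma tensorOp_elemTensor {N : ℕ} (A : Fin N → Matrix (Fin 2) (Fin 2) ℂ) (v : Fin N → Qubit) :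
    tensorOp A (elemTensor v) =
      elemTensor fun i => Matrix.toEuclideanCLM (𝕜 := ℂ) (A i) (v i) := by
  ext s
  rw [tensorOp_apply]
  simp only [elemTensor, ← Finset.prod_mul_distrib]
  rw [← Fintype.prod_sum fun i a => A i (s i) a * v i a]
  simp only [Matrix.ofLp_toEuclideanCLM, Matrix.mulVec, dotProduct]

/-- The identification of Mathlib's algebraic tensor power of `ℂ²` with `SpinSpace N`. -/
def tensorPowerEquiv (N : ℕ) : PiTensorProduct ℂ (fun _ : Fin N => Qubit) ≃ₗ[ℂ] SpinSpace N :=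
  (Basis.piTensorProduct fun _ : Fin N =>
    (EuclideanSpace.basisFun (Fin 2) ℂ).toBasis).equivFun.trans
    (WithLp.linearEquiv 2 ℂ ((Fin N → Fin 2) → ℂ)).symm

lemma tensorPowerEquiv_tprod {N : ℕ} (v : Fin N → Qubit) :
    tensorPowerEquiv N (PiTensorProduct.tprod ℂ v) = elemTensor v := by
  ext s
  simp [tensorPowerEquiv, elemTensor]

/-- The unitary that permutes the tensor factors according to `π`. -/
def permOp {N : ℕ} (π : Equiv.Perm (Fin N)) : SpinSpace N →ₗ[ℂ] SpinSpace N where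
  toFun ψ := WithLp.toLp 2 fun s => ψ (s ∘ π)
  map_add' _ _ := rfl
  map_smul' _ _ := rfl

lemma permOp_elemTensor {N : ℕ} (π : Equiv.Perm (Fin N)) (v : Fin N → Qubit) :
    permOp π (elemTensor v) = elemTensor (v ∘ π.symm) := by
  ext s
  exact Fintype.prod_equiv π _ _ (by simp)

/-- `Sym^N(ℂ²)`: the vectors that are fixed by all permutations of the tensor factors. -/
def symSubspace (N : ℕ) : Submodule ℂ (SpinSpace N) where
  carrier := {ψ | ∀ π : Equiv.Perm (Fin N), permOp π ψ = ψ}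
  add_mem' ha hb π := by rw [map_add, ha π, hb π]
  zero_mem' π := map_zero _
  smul_mem' c _ ha π := by rw [map_smul, ha π]

/-- `Sym^N(ℂ²)` as a Hilbert space of its own, with the scalar product inherited from
`ℂ² ⊗ ⋯ ⊗ ℂ²`. -/
def SymSpace (N : ℕ) : Type := symSubspace N

instance (N : ℕ) : NormedAddCommGroup (SymSpace N) :=
  Submodule.normedAddCommGroup (symSubspace N)

instance (N : ℕ) : InnerProductSpace ℂ (SymSpace N) :=
  Submodule.innerProductSpace (symSubspace N)

instance (N : ℕ) : Inner ℂ (SymSpace N) := InnerProductSpace.toInner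

instance (N : ℕ) : FiniteDimensional ℂ (SymSpace N) :=
  inferInstanceAs (FiniteDimensional ℂ (symSubspace N))

/-- The inclusion of `Sym^N(ℂ²)` into `ℂ² ⊗ ⋯ ⊗ ℂ²`. -/
def symIncl (N : ℕ) : SymSpace N →ₗᵢ[ℂ] SpinSpace N :=
  (symSubspace N).subtypeₗᵢ

lemma symIncl_mem {N : ℕ} (ψ : SymSpace N) : symIncl N ψ ∈ symSubspace N := ψ.2

/-- A vector of `ℂ² ⊗ ⋯ ⊗ ℂ²` that is fixed by all permutations, as an element of `Sym^N(ℂ²)`. -/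
def SymSpace.mk {N : ℕ} (ψ : SpinSpace N) (hψ : ψ ∈ symSubspace N) : SymSpace N := ⟨ψ, hψ⟩

lemma symIncl_mk {N : ℕ} (ψ : SpinSpace N) (hψ : ψ ∈ symSubspace N) :
    symIncl N (SymSpace.mk ψ hψ) = ψ := rfl

/-! ### The quantum Curie-Weiss Hamiltonian -/

/-- The Pauli matrix `σ₁`. -/
def pauli1 : Matrix (Fin 2) (Fin 2) ℂ := !![0, 1; 1, 0]

/-- The Pauli matrix `σ₃`. -/
def pauli3 : Matrix (Fin 2) (Fin 2) ℂ := !![1, 0; 0, -1]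

/-- `I ⊗ ⋯ ⊗ A ⊗ ⋯ ⊗ I` with `A` in the `j`-th slot. -/
def siteOp {N : ℕ} (A : Matrix (Fin 2) (Fin 2) ℂ) (j : Fin N) : SpinSpace N →L[ℂ] SpinSpace N :=
  tensorOp (Function.update (fun _ => 1) j A)

/-- `(1/N) (-(J/(2N)) ∑_{i,j} σ₃(i) σ₃(j) - B ∑_j σ₁(j))`, an operator on `ℂ² ⊗ ⋯ ⊗ ℂ²`. -/
def quantumCW (J B : ℝ) (N : ℕ) : SpinSpace N →L[ℂ] SpinSpace N :=
  (1 / (N : ℂ)) •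
    ((-((J : ℂ) / (2 * (N : ℂ)))) •
        (∑ i : Fin N, ∑ j : Fin N, siteOp pauli3 i ∘L siteOp pauli3 j)
      - (B : ℂ) • ∑ j : Fin N, siteOp pauli1 j)

lemma permOp_tensorOp {N : ℕ} (π : Equiv.Perm (Fin N)) (A : Fin N → Matrix (Fin 2) (Fin 2) ℂ)
    (ψ : SpinSpace N) : permOp π (tensorOp A ψ) = tensorOp (A ∘ π.symm) (permOp π ψ) := by
  ext s
  rw [tensorOp_apply]
  change tensorOp A ψ (s ∘ π) = ∑ t, (∏ i, (A ∘ π.symm) i (s i) (t i)) * ψ (t ∘ π)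
  rw [tensorOp_apply]
  refine Fintype.sum_equiv (Equiv.arrowCongr π (Equiv.refl _)) _ _ fun t => ?_
  congr 1
  · exact Fintype.prod_equiv π _ _ (by simp)
  · exact congrArg ψ (by ext i; simp)

lemma permOp_siteOp {N : ℕ} (π : Equiv.Perm (Fin N)) (A : Matrix (Fin 2) (Fin 2) ℂ) (j : Fin N)
    (ψ : SpinSpace N) : permOp π (siteOp A j ψ) = siteOp A (π j) (permOp π ψ) := by
  have h : (Function.update (fun _ : Fin N => (1 : Matrix (Fin 2) (Fin 2) ℂ)) j A) ∘ π.symm =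
      Function.update (fun _ => 1) (π j) A := by
    funext i
    by_cases hi : i = π j
    · subst hi; simp
    · have : π.symm i ≠ j := fun h => hi (by simp [← h])
      simp [hi, this]
  rw [siteOp, permOp_tensorOp, h, siteOp]

lemma quantumCW_mem (J B : ℝ) (N : ℕ) {ψ : SpinSpace N} (hψ : ψ ∈ symSubspace N) :
    quantumCW J B N ψ ∈ symSubspace N := by
  intro π
  have h3 : permOp π (∑ i : Fin N, ∑ j : Fin N, siteOp pauli3 i (siteOp pauli3 j ψ)) =
      ∑ i : Fin N, ∑ j : Fin N, siteOp pauli3 i (siteOp pauli3 j ψ) := by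
    simp only [map_sum, permOp_siteOp, hψ π]
    rw [Equiv.sum_comp π fun i => ∑ j, siteOp pauli3 i (siteOp pauli3 (π j) ψ)]
    exact Finset.sum_congr rfl fun i _ =>
      Equiv.sum_comp π fun j => siteOp pauli3 i (siteOp pauli3 j ψ)
  have h1 : permOp π (∑ j : Fin N, siteOp pauli1 j ψ) = ∑ j : Fin N, siteOp pauli1 j ψ := by
    simp only [map_sum, permOp_siteOp, hψ π]
    exact Equiv.sum_comp π fun j => siteOp pauli1 j ψ
  have e : quantumCW J B N ψ = (1 / (N : ℂ)) •
    ((-((J : ℂ) / (2 * (N : ℂ)))) • (∑ i : Fin N, ∑ j : Fin N, siteOp pauli3 i (siteOp pauli3 j ψ))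
      - (B : ℂ) • ∑ j : Fin N, siteOp pauli1 j ψ) := by
    simp [quantumCW]
  rw [e, map_smul, map_sub, map_smul, map_smul, h3, h1]

/-- The restriction of the quantum Curie-Weiss Hamiltonian to the invariant subspace
`Sym^N(ℂ²)`, as an element of `B(Sym^N(ℂ²))`. -/
def quantumCWSym (J B : ℝ) (N : ℕ) : SymSpace N →L[ℂ] SymSpace N :=
  LinearMap.toContinuousLinearMap
    { toFun := fun ψ =>
        SymSpace.mk (quantumCW J B N (symIncl N ψ)) (quantumCW_mem J B N (symIncl_mem ψ))
      map_add' := fun ψ χ => (symIncl N).injective <| by simp [symIncl_mk]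
      map_smul' := fun c ψ => (symIncl N).injective <| by simp [symIncl_mk] }

lemma symIncl_quantumCWSym (J B : ℝ) (N : ℕ) (ψ : SymSpace N) :
    symIncl N (quantumCWSym J B N ψ) = quantumCW J B N (symIncl N ψ) := rfl

/-! ### Coherent spin states and the quantization maps of the sphere -/

/-- The closed unit ball `B³` of `ℝ³`. -/
abbrev Ball3 : Type := Metric.closedBall (0 : EuclideanSpace ℝ (Fin 3)) 1

/-- The unit sphere `S²` of `ℝ³`. -/
abbrev Sphere2 : Type := Metric.sphere (0 : EuclideanSpace ℝ (Fin 3)) 1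

/-- The surface measure `dΩ` of `S²`, of total mass `4π`. -/
def sphereMeasure : Measure Sphere2 :=
  (volume : Measure (EuclideanSpace ℝ (Fin 3))).toSphere

instance : IsFiniteMeasure sphereMeasure := by unfold sphereMeasure; infer_instance

lemma sphereMeasure_real_univ : sphereMeasure.real Set.univ = 4 * Real.pi := by
  rw [sphereMeasure, Measure.toSphere_real_apply_univ, Measure.real,
    EuclideanSpace.volume_ball_fin_three]
  rw [ENNReal.ofReal_one, one_pow, one_mul, ENNReal.toReal_ofReal (by positivity)]
  simp
  ring

/-- The polar angle `θ` of a point of the sphere: `z = cos θ`. -/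
def polarAngle (Ω : Sphere2) : ℝ := Real.arccos (Ω.1 2)

/-- The azimuthal angle `φ ∈ (-π, π]` of a point of the sphere: `x + i y = e^{iφ} sin θ`
(and `φ = 0` at the two poles). -/
def azimuth (Ω : Sphere2) : ℝ := Complex.arg (⟨Ω.1 0, Ω.1 1⟩ : ℂ)

/-- The unit vector `|Ω⟩₁ = cos(θ/2) |↑⟩ + e^{iφ} sin(θ/2) |↓⟩`. -/
def coherent1 (Ω : Sphere2) : Qubit :=
  !₂[(Real.cos (polarAngle Ω / 2) : ℂ),
    Complex.exp (Complex.I * (azimuth Ω : ℂ)) * (Real.sin (polarAngle Ω / 2) : ℂ)]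

lemma elemTensor_const_mem {N : ℕ} (v : Qubit) :
    elemTensor (fun _ : Fin N => v) ∈ symSubspace N :=
  fun π => permOp_elemTensor π _

/-- The `N`-coherent spin state `|Ω⟩_N = |Ω⟩₁ ⊗ ⋯ ⊗ |Ω⟩₁` in `Sym^N(ℂ²)`. -/
def coherent (N : ℕ) (Ω : Sphere2) : SymSpace N :=
  SymSpace.mk (elemTensor fun _ => coherent1 Ω) (elemTensor_const_mem _)

/-- The operator `|Ω⟩⟨Ω|_N` on `Sym^N(ℂ²)`. -/
def coherentProj (N : ℕ) (Ω : Sphere2) : SymSpace N →L[ℂ] SymSpace N :=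
  InnerProductSpace.rankOne ℂ (coherent N Ω) (coherent N Ω)

/-- The quantization map `Q'_{1/N}(f) = (N+1)/(4π) ∫_{S²} f(Ω) |Ω⟩⟨Ω|_N dΩ` on continuous
functions on the sphere, with values in `B(Sym^N(ℂ²))`. -/
def sphereQuantization (N : ℕ) (f : C(Sphere2, ℂ)) : SymSpace N →L[ℂ] SymSpace N :=
  (((N : ℂ) + 1) / (4 * (Real.pi : ℂ))) • ∫ Ω, f Ω • coherentProj N Ω ∂sphereMeasure

lemma norm_coherent1 (Ω : Sphere2) : ‖coherent1 Ω‖ = 1 := by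
  have h : ‖Complex.exp (Complex.I * (azimuth Ω : ℂ))‖ = 1 := by
    rw [mul_comm]; exact Complex.norm_exp_ofReal_mul_I _
  rw [EuclideanSpace.norm_eq, Real.sqrt_eq_one]
  simp only [coherent1, Fin.sum_univ_two, norm_mul, Matrix.cons_val_zero,
    Matrix.cons_val_one, h, Complex.norm_real, one_mul, Real.norm_eq_abs, sq_abs]
  exact Real.cos_sq_add_sin_sq _

lemma norm_coherent (N : ℕ) (Ω : Sphere2) : ‖coherent N Ω‖ = 1 := by
  have h : inner ℂ (coherent N Ω) (coherent N Ω) = 1 := by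
    rw [← (symIncl N).inner_map_map, coherent, symIncl_mk, inner_elemTensor]
    simp [inner_self_eq_norm_sq_to_K, norm_coherent1]
  rw [@norm_eq_sqrt_re_inner ℂ, h]
  simp

lemma stronglyMeasurable_coherent (N : ℕ) : StronglyMeasurable (coherent N) := by
  have hc : ∀ k : Fin 3, Measurable fun Ω : Sphere2 => Ω.1 k := fun k =>
    (by fun_prop : Continuous fun Ω : Sphere2 => Ω.1 k).measurable
  have hθ : Measurable polarAngle := Real.continuous_arccos.measurable.comp (hc 2)
  have hφ : Measurable azimuth := by
    refine Complex.measurable_arg.comp ?_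
    have : (fun Ω : Sphere2 => (⟨Ω.1 0, Ω.1 1⟩ : ℂ)) =
        fun Ω : Sphere2 => ((Ω.1 0 : ℝ) : ℂ) + ((Ω.1 1 : ℝ) : ℂ) * Complex.I := by
      funext Ω
      exact Complex.mk_eq_add_mul_I _ _
    rw [this]
    have h0 := hc 0
    have h1 := hc 1
    fun_prop
  have h1 : ∀ a : Fin 2, Measurable fun Ω => coherent1 Ω a := by
    intro a
    fin_cases a
    · simp only [coherent1]
      change Measurable fun Ω => (Real.cos (polarAngle Ω / 2) : ℂ)
      fun_prop
    · change Measurable fun Ω => Complex.exp (Complex.I * (azimuth Ω : ℂ)) *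
        (Real.sin (polarAngle Ω / 2) : ℂ)
      fun_prop
  borelize (SymSpace N)
  have he : IsClosedEmbedding (symIncl N) := (symIncl N).isometry.isClosedEmbedding
  have : SecondCountableTopology (SymSpace N) := he.isEmbedding.secondCountableTopology
  refine Measurable.stronglyMeasurable (he.measurableEmbedding.measurable_comp_iff.1 ?_)
  refine (WithLp.measurable_toLp 2 _).comp ?_
  exact measurable_pi_lambda _ fun s => Finset.measurable_prod _ fun i _ => h1 (s i)

/-- The integrand in the definition of `sphereQuantization` is integrable. -/
lemma integrable_sphereQuantization (N : ℕ) (f : C(Sphere2, ℂ)) :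
    Integrable (fun Ω => f Ω • coherentProj N Ω) sphereMeasure := by
  have hm : AEStronglyMeasurable (fun Ω => f Ω • coherentProj N Ω) sphereMeasure := by
    refine f.continuous.aestronglyMeasurable.smul ?_
    have hc := (stronglyMeasurable_coherent N).aestronglyMeasurable
      (μ := sphereMeasure)
    have hcont : Continuous fun v : SymSpace N => InnerProductSpace.rankOne ℂ v v := by
      have h1 : Continuous fun v : SymSpace N => innerSL ℂ v := (innerSL ℂ).continuous
      have h2 := (ContinuousLinearMap.smulRightL ℂ (SymSpace N) (SymSpace N)).continuous.comp h1
      exact h2.clm_apply continuous_id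
    exact hcont.comp_aestronglyMeasurable hc
  refine Integrable.of_bound hm ‖f‖ (Eventually.of_forall fun Ω => ?_)
  rw [norm_smul, coherentProj, InnerProductSpace.norm_rankOne, norm_coherent]
  simpa using f.norm_coe_le_norm Ω

/-- `sphereQuantization` is the operator that is defined by the integral in the weak sense. -/
lemma inner_sphereQuantization (N : ℕ) (f : C(Sphere2, ℂ)) (χ ψ : SymSpace N) :
    inner ℂ χ (sphereQuantization N f ψ) =
      (((N : ℂ) + 1) / (4 * (Real.pi : ℂ))) *
        ∫ Ω, f Ω * (inner ℂ χ (coherent N Ω) * inner ℂ (coherent N Ω) ψ) ∂sphereMeasure := by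
  have hi := integrable_sphereQuantization N f
  have h := ((innerSL ℂ χ).comp (ContinuousLinearMap.apply ℂ (SymSpace N) ψ)).integral_comp_comm
    hi
  simp only [ContinuousLinearMap.comp_apply, ContinuousLinearMap.apply_apply,
    innerSL_apply_apply] at h
  rw [sphereQuantization, smul_apply, inner_smul_right, ← h]
  congr 2
  funext Ω
  simp [coherentProj, inner_smul_right]
  exact Or.inl (mul_comm _ _)

/-! ### The classical Curie-Weiss Hamiltonian -/

/-- `h(x, y, z) = -((J/2) z² + B x)` on the closed unit ball `B³`; the coordinates
`x, y, z` are those with the indices `0, 1, 2`. -/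
def classicalCW (J B : ℝ) : C(Ball3, ℝ) where
  toFun p := -(J / 2 * p.1 2 ^ 2 + B * p.1 0)
  continuous_toFun := by fun_prop

/-- The restriction to `S²` of a real function on `B³`, as a complex function. -/
def restrictSphere (f : C(Ball3, ℝ)) : C(Sphere2, ℂ) where
  toFun Ω := (f ⟨Ω.1, Metric.sphere_subset_closedBall Ω.2⟩ : ℂ)
  continuous_toFun := by fun_prop

end CurieWeiss

end

noncomputable section

namespace CurieWeiss

open ComplexConjugate

/-! On the symmetric subspace both operators are combinations of the same collective operators. With
S₃ and S₁ the sums of σ₃(j) and σ₁(j), the Hamiltonian is -(J/2) S₃²/N² - B S₁/N, while the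
quantization of the classical one is exactly -(J/2) S₃²/((N+2)(N+3)) - (J/2)/(N+3) - B S₁/(N+2)
(`symIncl_sphereQuantization_classicalCW`). Since S₃² and S₁ have norm at most N² and N, comparing
coefficients bounds the difference by (3|J| + 2|B|)/N.

The exact formula comes from matrix elements in the product basis. The coordinates x and z are
bilinear in the components of the coherent vector and their conjugates, so every matrix element is a
combination of integrals of monomials in these. Rotations about the third axis kill the unbalanced
monomials, and the others are Beta integrals (`integral_coherentMonomial`). A symmetric vector
depends only on the number of down spins, so the sum over configurations collapses to binomial
coefficients, which cancel the factorials.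

The Beta integrals rest on the uniform distribution of the height on the sphere, obtained by
evaluating Gaussian moments of ℝ³ in Cartesian and in polar coordinates. -/

/-! ### Integration over the sphere -/

/-- Integration in polar coordinates of a function that splits into an angular and a radial
factor. -/
lemma integral_eq_toSphere_mul {h : EuclideanSpace ℝ (Fin 3) → ℝ} {F : Sphere2 → ℝ} {φ : ℝ → ℝ}
    (hF : ∀ (r : ℝ) (Ω : Sphere2), 0 < r → h (r • Ω.1) = F Ω * φ r) :
    ∫ x, h x = (∫ Ω, F Ω ∂sphereMeasure) * ∫ r in Set.Ioi (0 : ℝ), r ^ 2 * φ r := by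
  let μ : Measure (EuclideanSpace ℝ (Fin 3)) := volume
  have hd : Module.finrank ℝ (EuclideanSpace ℝ (Fin 3)) - 1 = 2 := by simp
  -- Polar decomposition lives on the complement of the origin, which is a null set.
  calc ∫ x, h x = ∫ x : ({(0)}ᶜ : Set (EuclideanSpace ℝ (Fin 3))), h x.1 ∂(μ.comap (↑)) := by
        rw [integral_subtype_comap (measurableSet_singleton _).compl fun x ↦ h x,
          restrict_compl_singleton]
    _ = ∫ x, F x.1 * φ x.2 ∂μ.toSphere.prod (.volumeIoiPow 2) := by
      rw [← hd, ← μ.measurePreserving_homeomorphUnitSphereProd.integral_comp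
        (Homeomorph.measurableEmbedding _)]
      refine integral_congr_ae (Eventually.of_forall fun x => ?_)
      have hx : 0 < ‖x.1‖ := norm_pos_iff.2 x.2
      have := hF ‖x.1‖ (homeomorphUnitSphereProd _ x).1 hx
      simp only [homeomorphUnitSphereProd_apply_fst_coe, smul_inv_smul₀ hx.ne'] at this
      simpa using this
    _ = (∫ Ω, F Ω ∂sphereMeasure) * ∫ r : Set.Ioi (0 : ℝ), φ r ∂.volumeIoiPow 2 :=
      integral_prod_mul _ fun r : Set.Ioi (0 : ℝ) => φ r
    _ = _ := by
      simp only [Measure.volumeIoiPow, ENNReal.ofReal]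
      rw [integral_withDensity_eq_integral_smul,
        integral_subtype_comap measurableSet_Ioi fun a : ℝ ↦ Real.toNNReal (a ^ 2) • φ a]
      · congr 1
        refine setIntegral_congr_fun measurableSet_Ioi fun x hx ↦ ?_
        simp only [NNReal.smul_def]
        rw [Real.coe_toNNReal _ (by positivity), smul_eq_mul]
      · exact (measurable_subtype_coe.pow_const _).real_toNNReal

lemma integral_Ioi_pow_mul_exp_neg_sq (k : ℕ) :
    ∫ x in Set.Ioi (0 : ℝ), x ^ k * Real.exp (-x ^ 2) = 1 / 2 * Real.Gamma (((k : ℝ) + 1) / 2) := by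
  have h := integral_rpow_mul_exp_neg_rpow (p := 2) (q := k) two_pos
    (by linarith [(Nat.cast_nonneg k : (0 : ℝ) ≤ k)])
  simpa [Real.rpow_natCast, Real.rpow_ofNat] using h

lemma integral_pow_mul_exp_neg_sq_of_even {k : ℕ} (hk : Even k) :
    ∫ x : ℝ, x ^ k * Real.exp (-x ^ 2) = Real.Gamma (((k : ℝ) + 1) / 2) := by
  have h := integral_comp_abs (f := fun x : ℝ => x ^ k * Real.exp (-x ^ 2))
  simp only [hk.pow_abs, sq_abs] at h
  rw [h, integral_Ioi_pow_mul_exp_neg_sq]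
  ring

lemma integral_exp_neg_sq : ∫ x : ℝ, Real.exp (-x ^ 2) = √Real.pi := by
  simpa using integral_gaussian 1

/-- The Gaussian moments of the third coordinate in `ℝ³`. -/
lemma integral_coord_pow_mul_exp_neg_norm_sq (k : ℕ) :
    ∫ x : EuclideanSpace ℝ (Fin 3), x 2 ^ k * Real.exp (-‖x‖ ^ 2) =
      Real.pi * ∫ z : ℝ, z ^ k * Real.exp (-z ^ 2) := by
  let f : Fin 3 → ℝ → ℝ := ![fun x => Real.exp (-x ^ 2), fun x => Real.exp (-x ^ 2),
    fun z => z ^ k * Real.exp (-z ^ 2)]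
  have h := integral_fintype_prod_volume_eq_prod f
  have e := (EuclideanSpace.volume_preserving_symm_measurableEquiv_toLp (Fin 3)).integral_comp'
    (fun x : Fin 3 → ℝ => ∏ i, f i (x i))
  rw [h] at e
  simp only [Fin.prod_univ_three, f, Matrix.cons_val_zero, Matrix.cons_val_one,
    Matrix.cons_val] at e
  rw [integral_exp_neg_sq, Real.mul_self_sqrt Real.pi_pos.le] at e
  rw [← e]
  refine integral_congr_ae (Eventually.of_forall fun x => ?_)
  simp only [EuclideanSpace.norm_sq_eq, Fin.sum_univ_three, Real.norm_eq_abs, sq_abs, neg_add,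
    Real.exp_add]
  simp
  ring

/-- The moments of the height function on the sphere. -/
lemma integral_height_pow_mul (k : ℕ) :
    (∫ Ω : Sphere2, Ω.1 2 ^ k ∂sphereMeasure) * (1 / 2 * Real.Gamma (((k : ℝ) + 3) / 2)) =
      Real.pi * ∫ z : ℝ, z ^ k * Real.exp (-z ^ 2) := by
  rw [← integral_coord_pow_mul_exp_neg_norm_sq,
    integral_eq_toSphere_mul (F := fun Ω => Ω.1 2 ^ k) (φ := fun r => r ^ k * Real.exp (-r ^ 2))]
  · have := integral_Ioi_pow_mul_exp_neg_sq (k + 2)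
    push_cast at this
    rw [show (k : ℝ) + 3 = k + 2 + 1 by ring, ← this]
    congr 2
    funext r
    ring
  · intro r Ω hr
    have : ‖Ω.1‖ = 1 := by simp
    simp only [norm_smul, this, PiLp.smul_apply, smul_eq_mul, mul_pow, mul_one, Real.norm_eq_abs,
      sq_abs]
    ring

lemma continuous_coord (k : Fin 3) : Continuous fun Ω : Sphere2 => Ω.1 k := by fun_prop

lemma integrable_of_continuous {E : Type*} [NormedAddCommGroup E] {f : Sphere2 → E}
    (hf : Continuous f) : Integrable f sphereMeasure := by
  simpa using (ContinuousMap.mk f hf).continuous.continuousOn.integrableOn_compact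
    (μ := sphereMeasure) isCompact_univ

/-- For even k the recursion Γ(t + 1) = t Γ(t) cancels the Gamma factors of the Gaussian identity
and leaves 4π/(k + 1). For odd k both sides vanish by parity. -/
lemma integral_height_pow (k : ℕ) :
    ∫ Ω : Sphere2, Ω.1 2 ^ k ∂sphereMeasure = 2 * Real.pi * ∫ z in (-1 : ℝ)..1, z ^ k := by
  have hm := integral_height_pow_mul k
  have hk : (0 : ℝ) < k + 1 := by positivity
  have hG : 0 < Real.Gamma (((k : ℝ) + 1) / 2) := Real.Gamma_pos_of_pos (by positivity)
  have hG' : Real.Gamma (((k : ℝ) + 3) / 2) =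
      ((k : ℝ) + 1) / 2 * Real.Gamma (((k : ℝ) + 1) / 2) := by
    rw [← Real.Gamma_add_one (by positivity)]
    congr 1
    ring
  rw [hG'] at hm
  rw [integral_pow]
  rcases Nat.even_or_odd k with he | ho
  · rw [integral_pow_mul_exp_neg_sq_of_even he] at hm
    rw [he.add_one.neg_one_pow]
    field_simp at hm ⊢
    simp only [one_pow]
    linear_combination hm
  · have h0 : ∫ z : ℝ, z ^ k * Real.exp (-z ^ 2) = 0 := by
      have := integral_neg_eq_self (fun z : ℝ => z ^ k * Real.exp (-z ^ 2)) volume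
      simp only [ho.neg_pow, even_two.neg_pow, neg_mul, integral_neg] at this
      linarith
    rw [h0, mul_zero] at hm
    rw [ho.add_one.neg_one_pow]
    have : ∫ Ω : Sphere2, Ω.1 2 ^ k ∂sphereMeasure = 0 := by
      refine (mul_eq_zero.1 hm).resolve_right ?_
      positivity
    simp [this]

/-- Archimedes' theorem for polynomials. -/
lemma integral_eval_height (P : Polynomial ℝ) :
    ∫ Ω : Sphere2, P.eval (Ω.1 2) ∂sphereMeasure = 2 * Real.pi * ∫ z in (-1 : ℝ)..1, P.eval z := by
  induction P using Polynomial.induction_on' with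
  | add p q hp hq =>
    simp only [Polynomial.eval_add]
    have hc (P : Polynomial ℝ) : Integrable (fun Ω : Sphere2 => P.eval (Ω.1 2)) sphereMeasure :=
      integrable_of_continuous (P.continuous.comp (continuous_coord 2))
    rw [integral_add (hc p) (hc q),
      intervalIntegral.integral_add (p.continuous.intervalIntegrable _ _)
      (q.continuous.intervalIntegrable _ _), hp, hq]
    ring
  | monomial k a =>
    simp only [Polynomial.eval_monomial]
    rw [integral_const_mul, intervalIntegral.integral_const_mul, integral_height_pow]
    ring

/-- In the variable (1 + z)/2 the uniform height becomes 4π times Lebesgue measure on [0, 1]. This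
is the base case of the Beta integral. -/
lemma integral_upper_weight_pow (n : ℕ) :
    ∫ Ω : Sphere2, ((1 + Ω.1 2) / 2) ^ n ∂sphereMeasure = 4 * Real.pi / (n + 1) := by
  have h := integral_eval_height ((Polynomial.C (1 / 2) * Polynomial.X + Polynomial.C (1 / 2)) ^ n)
  simp only [Polynomial.eval_pow, Polynomial.eval_add, Polynomial.eval_mul, Polynomial.eval_C,
    Polynomial.eval_X] at h
  rw [intervalIntegral.integral_comp_mul_add (fun x : ℝ => x ^ n) (by norm_num)] at h
  rw [show (fun Ω : Sphere2 => ((1 + Ω.1 2) / 2) ^ n) =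
    fun Ω : Sphere2 => (1 / 2 * Ω.1 2 + 1 / 2) ^ n by funext Ω; ring, h, integral_pow]
  norm_num
  ring

/-- The Beta integral on the sphere. -/
lemma integral_weights_pow (a b : ℕ) :
    ∫ Ω : Sphere2, ((1 + Ω.1 2) / 2) ^ a * ((1 - Ω.1 2) / 2) ^ b ∂sphereMeasure =
      4 * Real.pi * (a.factorial * b.factorial / (a + b + 1).factorial) := by
  induction b generalizing a with
  | zero =>
    simp only [pow_zero, mul_one, integral_upper_weight_pow, add_zero, Nat.factorial_succ]
    have := Nat.factorial_pos a
    push_cast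
    field_simp
    simp
  | succ b ih =>
    -- One factor (1 - z)/2 is replaced by 1 - (1 + z)/2. This raises the other exponent, so the
    -- induction needs all `a`.
    have e : (fun Ω : Sphere2 => ((1 + Ω.1 2) / 2) ^ a * ((1 - Ω.1 2) / 2) ^ (b + 1)) =
        fun Ω => ((1 + Ω.1 2) / 2) ^ a * ((1 - Ω.1 2) / 2) ^ b -
          ((1 + Ω.1 2) / 2) ^ (a + 1) * ((1 - Ω.1 2) / 2) ^ b := by
      funext Ω
      ring
    have hc := continuous_coord 2
    rw [e, integral_sub (integrable_of_continuous (by fun_prop))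
      (integrable_of_continuous (by fun_prop)), ih, ih]
    rw [show a + 1 + b + 1 = (a + b + 1) + 1 by ring, show a + (b + 1) + 1 = (a + b + 1) + 1 by ring,
      Nat.factorial_succ (a + b + 1), Nat.factorial_succ a, Nat.factorial_succ b]
    have := Nat.factorial_pos (a + b + 1)
    push_cast
    field_simp
    ring

/-- The action of a linear isometry on the sphere. -/
def sphereMap (R : EuclideanSpace ℝ (Fin 3) ≃ₗᵢ[ℝ] EuclideanSpace ℝ (Fin 3)) (Ω : Sphere2) :
    Sphere2 :=
  ⟨R Ω.1, by simp⟩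

lemma continuous_sphereMap (R : EuclideanSpace ℝ (Fin 3) ≃ₗᵢ[ℝ] EuclideanSpace ℝ (Fin 3)) :
    Continuous (sphereMap R) :=
  (R.continuous.comp continuous_subtype_val).subtype_mk _

/-- The surface measure of a set is three times the volume of the cone over it. An isometry
preserves volume and, being linear, carries cones to cones. -/
lemma measurePreserving_sphereMap
    (R : EuclideanSpace ℝ (Fin 3) ≃ₗᵢ[ℝ] EuclideanSpace ℝ (Fin 3)) :
    MeasurePreserving (sphereMap R) sphereMeasure sphereMeasure := by
  have hm := (continuous_sphereMap R).measurable
  refine ⟨hm, Measure.ext fun s hs => ?_⟩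
  rw [Measure.map_apply hm hs, sphereMeasure, Measure.toSphere_apply' _ (hm hs),
    Measure.toSphere_apply' _ hs]
  conv_rhs => rw [← R.measurePreserving.measure_preimage_equiv (f := R.toMeasurableEquiv)]
  congr 2
  ext x
  simp only [Set.mem_smul, Set.mem_image, Set.mem_preimage, Subtype.exists]
  constructor
  · rintro ⟨r, hr, _, ⟨y, hy, hys, rfl⟩, rfl⟩
    exact ⟨r, hr, R y, ⟨R y, by simpa using hy, hys, rfl⟩, by simp⟩
  · rintro ⟨r, hr, _, ⟨y, hy, hys, rfl⟩, h⟩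
    refine ⟨r, hr, R.symm y, ⟨R.symm y, by simpa using hy, ?_, rfl⟩, ?_⟩
    · simpa [sphereMap] using hys
    · apply R.injective
      simpa using h

/-! ### Rotations about the third axis and coherent monomials -/

/-- The rotation about the third axis by the angle `α`. -/
def rotZ (α : ℝ) : EuclideanSpace ℝ (Fin 3) ≃ₗᵢ[ℝ] EuclideanSpace ℝ (Fin 3) :=
  LinearIsometry.toLinearIsometryEquiv
    { toFun := fun x => !₂[Real.cos α * x 0 - Real.sin α * x 1,
        Real.sin α * x 0 + Real.cos α * x 1, x 2]
      map_add' := fun x y => by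
        ext i
        fin_cases i <;> simp <;> ring
      map_smul' := fun c x => by
        ext i
        fin_cases i <;> simp <;> ring
      norm_map' := fun x => by
        simp only [EuclideanSpace.norm_eq, Fin.sum_univ_three, Real.norm_eq_abs, sq_abs]
        congr 1
        simp
        linear_combination (x 0 ^ 2 + x 1 ^ 2) * Real.sin_sq_add_cos_sq α }
    rfl

lemma rotZ_apply (α : ℝ) (x : EuclideanSpace ℝ (Fin 3)) :
    rotZ α x = !₂[Real.cos α * x 0 - Real.sin α * x 1,
        Real.sin α * x 0 + Real.cos α * x 1, x 2] := rfl

/-- The point `x + i y` of the complex plane below a point of the sphere. -/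
def planar (Ω : Sphere2) : ℂ := (Ω.1 0 : ℂ) + (Ω.1 1 : ℂ) * Complex.I

lemma continuous_planar : Continuous planar := by
  unfold planar
  fun_prop

lemma planar_sphereMap_rotZ (α : ℝ) (Ω : Sphere2) :
    planar (sphereMap (rotZ α) Ω) = Complex.exp (α * Complex.I) * planar Ω := by
  have hI := Complex.I_mul_I
  simp only [planar, sphereMap, rotZ_apply, Complex.exp_mul_I]
  simp
  linear_combination (-Complex.sin α * (Ω.1 1 : ℂ)) * hI

/-- Rotation by π/m multiplies (x + iy)^m by -1 and fixes the height, so invariance of the measure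
makes the integral equal to its own negative. -/
lemma integral_planar_pow_mul {m : ℕ} (hm : m ≠ 0) {g : ℝ → ℂ} (hg : Continuous g) :
    ∫ Ω : Sphere2, planar Ω ^ m * g (Ω.1 2) ∂sphereMeasure = 0 := by
  let R := rotZ (Real.pi / m)
  have hc : Continuous fun Ω : Sphere2 => planar Ω ^ m * g (Ω.1 2) :=
    (continuous_planar.pow m).mul (hg.comp (continuous_coord 2))
  have hR := measurePreserving_sphereMap R
  have h := integral_map hR.measurable.aemeasurable
    (hc.aestronglyMeasurable (μ := sphereMeasure.map (sphereMap R)))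
  rw [hR.map_eq] at h
  have e : ∀ Ω : Sphere2, planar (sphereMap R Ω) ^ m * g ((sphereMap R Ω).1 2) =
      -(planar Ω ^ m * g (Ω.1 2)) := by
    intro Ω
    have hm' : (m : ℂ) ≠ 0 := Nat.cast_ne_zero.2 hm
    have h1 : Complex.exp ((Real.pi / m : ℝ) * Complex.I) ^ m = -1 := by
      rw [← Complex.exp_nat_mul, ← Complex.exp_pi_mul_I]
      congr 1
      push_cast
      field_simp
    rw [planar_sphereMap_rotZ, mul_pow, h1]
    simp [R, sphereMap, rotZ_apply]
  simp only [e, integral_neg] at h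
  exact CharZero.eq_neg_self_iff.1 h

/-! ### Coherent vectors and the coordinates of the sphere. -/

lemma coord_sq_sum (Ω : Sphere2) : Ω.1 0 ^ 2 + Ω.1 1 ^ 2 + Ω.1 2 ^ 2 = 1 := by
  have h : ‖Ω.1‖ ^ 2 = 1 := by simp
  rw [EuclideanSpace.norm_sq_eq] at h
  simpa only [Fin.sum_univ_three, Real.norm_eq_abs, sq_abs] using h

lemma cos_polarAngle (Ω : Sphere2) : Real.cos (polarAngle Ω) = Ω.1 2 := by
  have h := coord_sq_sum Ω
  have : |Ω.1 2| ≤ 1 := by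
    rw [← sq_le_one_iff_abs_le_one]
    nlinarith [sq_nonneg (Ω.1 0), sq_nonneg (Ω.1 1)]
  exact Real.cos_arccos (abs_le.1 this).1 (abs_le.1 this).2

/-- This is the polar form of x + iy, whose modulus is √(1 - z²). At the poles both sides vanish, so
the default value of the argument there is harmless. -/
lemma exp_azimuth_mul_sin_polarAngle (Ω : Sphere2) :
    Complex.exp (Complex.I * (azimuth Ω : ℂ)) * (Real.sin (polarAngle Ω) : ℂ) = planar Ω := by
  have h := coord_sq_sum Ω
  have hn : ‖(⟨Ω.1 0, Ω.1 1⟩ : ℂ)‖ = Real.sin (polarAngle Ω) := by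
    rw [polarAngle, Real.sin_arccos, Complex.norm_def, Complex.normSq_mk]
    congr 1
    linarith
  have := Complex.norm_mul_exp_arg_mul_I (⟨Ω.1 0, Ω.1 1⟩ : ℂ)
  rw [hn] at this
  rw [planar, ← Complex.mk_eq_add_mul_I, ← this, azimuth]
  ring_nf

/-- By the half-angle formulas, this and the next two products are polynomial in x, y, z, so the
integrals can be computed without angles. -/
lemma coherent1_zero_mul_conj (Ω : Sphere2) :
    coherent1 Ω 0 * conj (coherent1 Ω 0) = (((1 + Ω.1 2) / 2 : ℝ) : ℂ) := by
  have h := Real.cos_sq (polarAngle Ω / 2)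
  rw [mul_div_cancel₀ _ two_ne_zero, cos_polarAngle] at h
  simp only [coherent1, Matrix.cons_val_zero, Complex.conj_ofReal]
  rw [← Complex.ofReal_mul, ← sq, h]
  congr 1
  ring

lemma coherent1_one_mul_conj (Ω : Sphere2) :
    coherent1 Ω 1 * conj (coherent1 Ω 1) = (((1 - Ω.1 2) / 2 : ℝ) : ℂ) := by
  have h := Real.sin_sq (polarAngle Ω / 2)
  rw [Real.cos_sq, mul_div_cancel₀ _ two_ne_zero, cos_polarAngle] at h
  have h1 : ‖Complex.exp (Complex.I * (azimuth Ω : ℂ))‖ = 1 := by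
    rw [mul_comm]; exact Complex.norm_exp_ofReal_mul_I _
  rw [Complex.mul_conj, Complex.normSq_eq_norm_sq]
  simp only [coherent1, Matrix.cons_val_one, norm_mul, h1, one_mul, Complex.norm_real,
    Real.norm_eq_abs, sq_abs, h, Matrix.cons_val_fin_one]
  congr 1
  ring

lemma coherent1_one_mul_conj_zero (Ω : Sphere2) :
    coherent1 Ω 1 * conj (coherent1 Ω 0) = planar Ω / 2 := by
  have h := Real.sin_two_mul (polarAngle Ω / 2)
  rw [mul_div_cancel₀ _ two_ne_zero] at h
  rw [← exp_azimuth_mul_sin_polarAngle, h]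
  simp only [coherent1, Matrix.cons_val_zero, Matrix.cons_val_one, Complex.conj_ofReal,
    Matrix.cons_val_fin_one]
  push_cast
  ring

/-- The monomial `v₀ᵃ v₁ᵇ v̄₀ᶜ v̄₁ᵈ` in the components of the coherent vector. -/
def coherentMonomial (a b c d : ℕ) (Ω : Sphere2) : ℂ :=
  coherent1 Ω 0 ^ a * coherent1 Ω 1 ^ b * (conj (coherent1 Ω 0) ^ c * conj (coherent1 Ω 1) ^ d)

/-- Continuity fails at the south pole, where the phase has no limit. Measurability is read off from
the case N = 1 of the coherent states. -/
lemma measurable_coherent1 (a : Fin 2) : Measurable fun Ω => coherent1 Ω a := by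
  have h := ((symIncl 1).continuous.comp_stronglyMeasurable
    (stronglyMeasurable_coherent 1)).measurable
  have h2 : Measurable fun Ω => symIncl 1 (coherent 1 Ω) fun _ => a :=
    (by fun_prop : Continuous fun v : SpinSpace 1 => v fun _ => a).measurable.comp h
  simpa [coherent, symIncl_mk, elemTensor] using h2

lemma norm_coherent1_apply_le (Ω : Sphere2) (a : Fin 2) : ‖coherent1 Ω a‖ ≤ 1 :=
  (PiLp.norm_apply_le _ a).trans (norm_coherent1 Ω).le

lemma integrable_coherentMonomial (a b c d : ℕ) :
    Integrable (coherentMonomial a b c d) sphereMeasure := by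
  have h0 := measurable_coherent1 0
  have h1 := measurable_coherent1 1
  have hm : Measurable (coherentMonomial a b c d) := by
    unfold coherentMonomial
    have hs := Complex.continuous_conj.measurable
    exact ((h0.pow_const a).mul (h1.pow_const b)).mul
      (((hs.comp h0).pow_const c).mul ((hs.comp h1).pow_const d))
  refine Integrable.of_bound hm.aestronglyMeasurable 1 (Eventually.of_forall fun Ω => ?_)
  have n0 (k : ℕ) := pow_le_one₀ (n := k) (norm_nonneg _) (norm_coherent1_apply_le Ω 0)
  have n1 (k : ℕ) := pow_le_one₀ (n := k) (norm_nonneg _) (norm_coherent1_apply_le Ω 1)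
  simp only [coherentMonomial, norm_mul, norm_pow, RCLike.norm_conj]
  exact mul_le_one₀ (mul_le_one₀ (n0 _) (by positivity) (n1 _)) (by positivity)
    (mul_le_one₀ (n0 _) (by positivity) (n1 _))

lemma integral_coherentMonomial_self (a b : ℕ) :
    ∫ Ω, coherentMonomial a b a b Ω ∂sphereMeasure =
      4 * Real.pi * (a.factorial * b.factorial / (a + b + 1).factorial) := by
  have e : coherentMonomial a b a b = fun Ω : Sphere2 =>
      ((((1 + Ω.1 2) / 2) ^ a * ((1 - Ω.1 2) / 2) ^ b : ℝ) : ℂ) := by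
    funext Ω
    rw [Complex.ofReal_mul, Complex.ofReal_pow, Complex.ofReal_pow, ← coherent1_zero_mul_conj,
      ← coherent1_one_mul_conj, coherentMonomial]
    ring
  rw [e, integral_complex_ofReal, integral_weights_pow]
  push_cast
  rfl

/-- The m unpaired products v₁v̄₀ = (x + iy)/2 contribute (x + iy)^m/2^m, and the remaining factors
pair up to a function of the height. -/
lemma integral_coherentMonomial_of_gt (a d : ℕ) {m : ℕ} (hm : m ≠ 0) :
    ∫ Ω, coherentMonomial a (d + m) (a + m) d Ω ∂sphereMeasure = 0 := by
  have e : coherentMonomial a (d + m) (a + m) d = fun Ω : Sphere2 => planar Ω ^ m *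
      ((((1 + Ω.1 2) / 2) ^ a * ((1 - Ω.1 2) / 2) ^ d / 2 ^ m : ℝ) : ℂ) := by
    funext Ω
    rw [Complex.ofReal_div, Complex.ofReal_mul, Complex.ofReal_pow, Complex.ofReal_pow,
      ← coherent1_zero_mul_conj, ← coherent1_one_mul_conj,
      show planar Ω = 2 * (planar Ω / 2) by ring, ← coherent1_one_mul_conj_zero, coherentMonomial]
    push_cast
    field_simp
    ring
  rw [e]
  exact integral_planar_pow_mul hm (g := fun z : ℝ =>
    ((((1 + z) / 2) ^ a * ((1 - z) / 2) ^ d / 2 ^ m : ℝ) : ℂ)) (by fun_prop)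

/-- The orthogonality relations of the coherent monomials. -/
lemma integral_coherentMonomial {a b c d : ℕ} (h : a + b = c + d) :
    ∫ Ω, coherentMonomial a b c d Ω ∂sphereMeasure =
      if b = d then 4 * (Real.pi : ℂ) * (a.factorial * b.factorial / (a + b + 1).factorial)
      else 0 := by
  rcases lt_trichotomy b d with hlt | rfl | hlt
  · obtain ⟨m, rfl⟩ := Nat.exists_eq_add_of_lt hlt
    obtain rfl : a = c + (m + 1) := by omega
    have hz := integral_coherentMonomial_of_gt c b m.succ_ne_zero
    -- The case b < d is the complex conjugate of the case b > d.
    have hs := integral_conj (μ := sphereMeasure)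
      (f := coherentMonomial c (b + (m + 1)) (c + (m + 1)) b)
    rw [Nat.succ_eq_add_one] at hz
    rw [hz, map_zero] at hs
    rw [if_neg (by omega), ← hs]
    congr 1
    funext Ω
    simp only [coherentMonomial, map_mul, map_pow, Complex.conj_conj]
    ring
  · obtain rfl : a = c := by omega
    rw [if_pos rfl, integral_coherentMonomial_self]
  · obtain ⟨m, rfl⟩ := Nat.exists_eq_add_of_lt hlt
    obtain rfl : c = a + (m + 1) := by omega
    rw [if_neg (by omega)]
    exact integral_coherentMonomial_of_gt a d m.succ_ne_zero

/-! ### Symmetric vectors in the product basis -/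

/-- The number of sites at which a spin configuration takes the value `a`. -/
def spinCount {N : ℕ} (s : Fin N → Fin 2) (a : Fin 2) : ℕ :=
  (Finset.univ.filter fun i => s i = a).card

lemma filter_eq_zero_eq_compl {N : ℕ} (s : Fin N → Fin 2) :
    (Finset.univ.filter fun i => s i = 0) = (Finset.univ.filter fun i => s i = 1)ᶜ := by
  ext i
  simp only [Finset.mem_filter, Finset.mem_univ, true_and, Finset.mem_compl]
  omega

lemma spinCount_add {N : ℕ} (s : Fin N → Fin 2) : spinCount s 0 + spinCount s 1 = N := by
  have := Finset.card_compl_add_card (Finset.univ.filter fun i => s i = 1)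
  rwa [← filter_eq_zero_eq_compl, Fintype.card_fin] at this

lemma prod_spin {M : Type*} [CommMonoid M] {N : ℕ} (s : Fin N → Fin 2) (v : Fin 2 → M) :
    ∏ i, v (s i) = v 0 ^ spinCount s 0 * v 1 ^ spinCount s 1 := by
  rw [Finset.prod_comp v s, ← Fin.prod_univ_two fun a => v a ^ spinCount s a]
  refine Finset.prod_subset (Finset.subset_univ _) fun a _ ha => ?_
  have : (Finset.univ.filter fun i => s i = a) = ∅ := by
    ext i
    simp only [Finset.mem_filter, Finset.mem_univ, true_and, Finset.notMem_empty, iff_false]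
    rintro rfl
    exact ha (Finset.mem_image_of_mem _ (Finset.mem_univ i))
  rw [this, Finset.card_empty, pow_zero]

lemma sum_spin {M : Type*} [AddCommMonoid M] {N : ℕ} (s : Fin N → Fin 2) (v : Fin 2 → M) :
    ∑ i, v (s i) = spinCount s 0 • v 0 + spinCount s 1 • v 1 :=
  prod_spin (M := Multiplicative M) s v

lemma card_spinCount_one_eq (N k : ℕ) :
    (Finset.univ.filter fun t : Fin N → Fin 2 => spinCount t 1 = k).card = N.choose k := by
  have h := Finset.card_powersetCard k (Finset.univ : Finset (Fin N))
  rw [Finset.card_univ, Fintype.card_fin] at h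
  rw [← h]
  refine Finset.card_nbij' (fun t => Finset.univ.filter fun i => t i = 1)
    (fun A i => if i ∈ A then 1 else 0) ?_ ?_ ?_ ?_
  · intro t ht
    simpa [Finset.mem_powersetCard, spinCount] using (Finset.mem_filter.1 ht).2
  · intro A hA
    refine Finset.mem_filter.2 ⟨Finset.mem_univ _, ?_⟩
    simpa [Finset.mem_powersetCard, spinCount] using hA
  · intro t _
    funext i
    by_cases hi : t i = 1
    · simp [hi]
    · simp only [Finset.mem_filter, Finset.mem_univ, true_and, hi, if_false]
      omega
  · intro A _
    ext i
    simp

/-- A bijection between the two sets of down spins extends to a permutation of all sites. -/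
lemma exists_comp_perm_eq {N : ℕ} {s t : Fin N → Fin 2} (h : spinCount s 1 = spinCount t 1) :
    ∃ π : Equiv.Perm (Fin N), s ∘ π = t := by
  have hc : Fintype.card {i // t i = 1} = Fintype.card {i // s i = 1} := by
    rw [Fintype.card_subtype, Fintype.card_subtype]
    exact h.symm
  let e := Fintype.equivOfCardEq hc
  refine ⟨e.extendSubtype, funext fun i => ?_⟩
  by_cases hi : t i = 1
  · rw [Function.comp_apply, e.extendSubtype_mem i hi, hi]
  · have := e.extendSubtype_not_mem i hi
    rw [Function.comp_apply]
    omega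

/-- The components of a symmetric vector depend only on the number of flipped spins. -/
lemma exists_eq_comp_spinCount {N : ℕ} {ψ : SpinSpace N} (hψ : ψ ∈ symSubspace N) :
    ∃ c : ℕ → ℂ, ∀ s, ψ s = c (spinCount s 1) := by
  have hf : Function.FactorsThrough (fun s => ψ s) fun s : Fin N → Fin 2 => spinCount s 1 := by
    intro s t hst
    obtain ⟨π, rfl⟩ := exists_comp_perm_eq hst
    exact (congrArg (fun χ : SpinSpace N => χ s) (hψ π)).symm
  exact ⟨Function.extend (fun s : Fin N → Fin 2 => spinCount s 1) (fun s => ψ s) 0,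
    fun s => (hf.extend_apply 0 s).symm⟩

lemma sum_ite_spinCount_eq (N k : ℕ) (c : ℕ → ℂ) :
    (∑ t : Fin N → Fin 2, if spinCount t 1 = k then c (spinCount t 1) else 0) =
      N.choose k * c k := by
  rw [← Finset.sum_filter, ← card_spinCount_one_eq, ← nsmul_eq_mul, ← Finset.sum_const]
  refine Finset.sum_congr rfl fun t ht => ?_
  rw [(Finset.mem_filter.1 ht).2]

/-! ### One-site operators in the product basis -/

/-- Identity factors away from `j` kill every configuration that differs from `s` at another site.
-/
lemma siteOp_apply {N : ℕ} (A : Matrix (Fin 2) (Fin 2) ℂ) (j : Fin N) (ψ : SpinSpace N)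
    (s : Fin N → Fin 2) :
    siteOp A j ψ s = ∑ b, A (s j) b * ψ (Function.update s j b) := by
  rw [siteOp, tensorOp_apply]
  symm
  refine Finset.sum_of_injOn (fun b => Function.update s j b)
    (Function.update_injective s j).injOn (fun _ _ => Finset.mem_coe.2 (Finset.mem_univ _)) ?_ ?_
  · intro t _ ht
    suffices h : ∃ i, i ≠ j ∧ s i ≠ t i by
      obtain ⟨i, hi, hst⟩ := h
      rw [Finset.prod_eq_zero (Finset.mem_univ i), zero_mul]
      simp [Function.update_of_ne hi, Matrix.one_apply_ne hst]
    by_contra! hcon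
    refine ht ⟨t j, Finset.mem_coe.2 (Finset.mem_univ _), funext fun i => ?_⟩
    by_cases hi : i = j
    · subst hi; simp
    · simp [Function.update_of_ne hi, hcon i hi]
  · intro b _
    congr 1
    rw [Finset.prod_eq_single j]
    · simp
    · intro i _ hi
      simp [Function.update_of_ne hi]
    · simp

/-- The sign of a spin. -/
def spinSign (a : Fin 2) : ℂ := if a = 0 then 1 else -1

lemma siteOp_pauli3_apply {N : ℕ} (j : Fin N) (ψ : SpinSpace N) (s : Fin N → Fin 2) :
    siteOp pauli3 j ψ s = spinSign (s j) * ψ s := by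
  rw [siteOp_apply, Fin.sum_univ_two]
  have h (b : Fin 2) (hb : s j = b) : Function.update s j b = s := by
    rw [← hb, Function.update_eq_self]
  rcases Fin.exists_fin_two.1 ⟨s j, rfl⟩ with hs | hs
  · simp [hs, h 0 hs, pauli3, spinSign]
  · simp [hs, h 1 hs, pauli3, spinSign]

/-- The configuration in which the `j`-th spin is flipped. -/
def flipAt {N : ℕ} (j : Fin N) (s : Fin N → Fin 2) : Fin N → Fin 2 :=
  Function.update s j (1 - s j)

lemma siteOp_pauli1_apply {N : ℕ} (j : Fin N) (ψ : SpinSpace N) (s : Fin N → Fin 2) :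
    siteOp pauli1 j ψ s = ψ (flipAt j s) := by
  rw [siteOp_apply, Fin.sum_univ_two, flipAt]
  rcases Fin.exists_fin_two.1 ⟨s j, rfl⟩ with hs | hs
  · simp [hs, pauli1]
  · simp [hs, pauli1]

lemma flipAt_involutive {N : ℕ} (j : Fin N) : Function.Involutive (flipAt j) := by
  intro s
  simp [flipAt]

lemma spinCount_flipAt_of_zero {N : ℕ} {j : Fin N} {s : Fin N → Fin 2} (h : s j = 0) :
    spinCount (flipAt j s) 1 = spinCount s 1 + 1 := by
  have hj : j ∉ Finset.univ.filter fun i => s i = 1 := by simp [h]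
  rw [spinCount, spinCount, ← Finset.card_insert_of_notMem hj]
  congr 1
  ext i
  by_cases hi : i = j
  · subst hi; simp [flipAt, h]
  · rw [Finset.mem_filter, Finset.mem_insert, Finset.mem_filter]
    simp [flipAt, hi]

lemma spinCount_flipAt_of_one {N : ℕ} {j : Fin N} {s : Fin N → Fin 2} (h : s j = 1) :
    spinCount (flipAt j s) 1 + 1 = spinCount s 1 := by
  have h' : flipAt j s j = 0 := by simp [flipAt, h]
  rw [← spinCount_flipAt_of_zero h', flipAt_involutive j s]

/-- The one-site Pauli operators are isometric. -/
lemma norm_siteOp_pauli3 {N : ℕ} (j : Fin N) (ψ : SpinSpace N) :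
    ‖siteOp pauli3 j ψ‖ = ‖ψ‖ := by
  rw [EuclideanSpace.norm_eq, EuclideanSpace.norm_eq]
  congr 1
  refine Finset.sum_congr rfl fun s _ => ?_
  rw [siteOp_pauli3_apply, norm_mul, spinSign]
  split_ifs <;> simp

lemma norm_siteOp_pauli1 {N : ℕ} (j : Fin N) (ψ : SpinSpace N) :
    ‖siteOp pauli1 j ψ‖ = ‖ψ‖ := by
  rw [EuclideanSpace.norm_eq, EuclideanSpace.norm_eq]
  congr 1
  simp only [siteOp_pauli1_apply]
  exact Equiv.sum_comp (flipAt_involutive j).toPerm fun s => ‖ψ s‖ ^ 2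

/-- Each term is diagonal, and the double sum of sign products is the square of the total
magnetization. -/
lemma sum_siteOp_pauli3_apply {N : ℕ} (ψ : SpinSpace N) (s : Fin N → Fin 2) :
    (∑ i : Fin N, ∑ j : Fin N, siteOp pauli3 i (siteOp pauli3 j ψ)) s =
      ((spinCount s 0 : ℂ) - spinCount s 1) ^ 2 * ψ s := by
  have h := sum_spin s spinSign
  simp only [spinSign, if_true, one_ne_zero, if_false, nsmul_eq_mul, mul_one] at h
  have h' : ∑ i, spinSign (s i) = (spinCount s 0 : ℂ) - spinCount s 1 := by
    simpa [spinSign, sub_eq_add_neg] using h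
  rw [← h', sq, Finset.sum_mul_sum, Finset.sum_mul]
  simp only [WithLp.ofLp_sum, Finset.sum_apply, siteOp_pauli3_apply, Finset.sum_mul, mul_assoc]

/-- Flipping an up spin raises the count of down spins by one, flipping a down spin lowers it. At
count zero the truncated subtraction is harmless because its coefficient is zero. -/
lemma sum_siteOp_pauli1_apply {N : ℕ} {ψ : SpinSpace N} {c : ℕ → ℂ}
    (hc : ∀ s, ψ s = c (spinCount s 1)) (s : Fin N → Fin 2) :
    (∑ j : Fin N, siteOp pauli1 j ψ) s =
      spinCount s 0 * c (spinCount s 1 + 1) + spinCount s 1 * c (spinCount s 1 - 1) := by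
  have h := sum_spin s fun a => if a = 0 then c (spinCount s 1 + 1) else c (spinCount s 1 - 1)
  simp only [if_true, one_ne_zero, if_false, nsmul_eq_mul] at h
  rw [← h]
  simp only [WithLp.ofLp_sum, Finset.sum_apply, siteOp_pauli1_apply]
  refine Finset.sum_congr rfl fun j _ => ?_
  rw [hc]
  split_ifs with hj
  · rw [spinCount_flipAt_of_zero hj]
  · have := spinCount_flipAt_of_one (show s j = 1 by omega)
    congr 1
    omega

/-! ### The quantization of the classical Hamiltonian -/

lemma symIncl_coherent_apply (N : ℕ) (Ω : Sphere2) (s : Fin N → Fin 2) :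
    symIncl N (coherent N Ω) s =
      coherent1 Ω 0 ^ spinCount s 0 * coherent1 Ω 1 ^ spinCount s 1 := by
  rw [coherent, symIncl_mk, ← prod_spin s fun a => coherent1 Ω a]
  rfl

/-- The matrix elements of `sphereQuantization` in the product basis. -/
lemma symIncl_sphereQuantization_apply (N : ℕ) (f : C(Sphere2, ℂ)) (ψ : SymSpace N)
    (s : Fin N → Fin 2) :
    symIncl N (sphereQuantization N f ψ) s =
      ((N : ℂ) + 1) / (4 * Real.pi) * ∑ t, (∫ Ω, f Ω * coherentMonomial (spinCount s 0)
        (spinCount s 1) (spinCount t 0) (spinCount t 1) Ω ∂sphereMeasure) * symIncl N ψ t := by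
  -- Applying to `ψ` and reading off component `s` is continuous and linear, so it passes under the
  -- operator-valued integral.
  have h := ((EuclideanSpace.proj (𝕜 := ℂ) s).comp ((symIncl N).toContinuousLinearMap.comp
    (ContinuousLinearMap.apply ℂ (SymSpace N) ψ))).integral_comp_comm
    (integrable_sphereQuantization N f)
  simp only [ContinuousLinearMap.comp_apply, ContinuousLinearMap.apply_apply,
    LinearIsometry.coe_toContinuousLinearMap, PiLp.proj_apply] at h
  rw [sphereQuantization, smul_apply, map_smul, PiLp.smul_apply, ← h, smul_eq_mul]
  congr 1
  simp only [← integral_mul_const]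
  rw [← integral_finsetSum]
  · refine integral_congr_ae (Eventually.of_forall fun Ω => ?_)
    simp only [smul_apply, coherentProj, InnerProductSpace.rankOne_apply, map_smul,
      PiLp.smul_apply, smul_eq_mul]
    rw [← (symIncl N).inner_map_map]
    simp only [PiLp.inner_apply, RCLike.inner_apply, symIncl_coherent_apply, Finset.sum_mul,
      Finset.mul_sum, coherentMonomial, map_mul, map_pow]
    exact Finset.sum_congr rfl fun t _ => by ring
  · intro t _
    refine Integrable.mul_const ?_ _
    exact (integrable_coherentMonomial _ _ _ _).bdd_mul f.continuous.aestronglyMeasurable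
      (Eventually.of_forall fun Ω => f.norm_coe_le_norm Ω)

lemma coord_zero_eq (Ω : Sphere2) : (Ω.1 0 : ℂ) =
    coherent1 Ω 0 * conj (coherent1 Ω 1) + coherent1 Ω 1 * conj (coherent1 Ω 0) := by
  have h := coherent1_one_mul_conj_zero Ω
  have h' := congrArg conj h
  simp only [map_mul, Complex.conj_conj, map_div₀, planar, map_add, Complex.conj_ofReal,
    Complex.conj_I, map_ofNat] at h'
  rw [planar] at h
  linear_combination -h - h'

lemma coord_two_eq (Ω : Sphere2) : (Ω.1 2 : ℂ) =
    coherent1 Ω 0 * conj (coherent1 Ω 0) - coherent1 Ω 1 * conj (coherent1 Ω 1) := by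
  rw [coherent1_zero_mul_conj, coherent1_one_mul_conj]
  push_cast
  ring

/-- Each coordinate has degree one in the vector and degree one in its conjugate, so equal total
degrees, as the orthogonality relations require, stay equal. -/
lemma restrictSphere_classicalCW_mul_coherentMonomial (J B : ℝ) (a b c d : ℕ) (Ω : Sphere2) :
    restrictSphere (classicalCW J B) Ω * coherentMonomial a b c d Ω =
      -(J / 2 : ℂ) * (coherentMonomial (a + 2) b (c + 2) d Ω -
        2 * coherentMonomial (a + 1) (b + 1) (c + 1) (d + 1) Ω +
        coherentMonomial a (b + 2) c (d + 2) Ω) -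
      B * (coherentMonomial (a + 1) b c (d + 1) Ω + coherentMonomial a (b + 1) (c + 1) d Ω) := by
  have h : restrictSphere (classicalCW J B) Ω =
      -((J / 2 : ℂ) * (Ω.1 2 : ℂ) ^ 2 + B * (Ω.1 0 : ℂ)) := by
    simp [restrictSphere, classicalCW]
  rw [h, coord_zero_eq, coord_two_eq]
  simp only [coherentMonomial]
  ring

/-- The z² part is diagonal in the number of down spins, while x shifts it by one. The monomials
have degree N + 2 and N + 1 respectively, whence (N + 3)! and (N + 2)!. -/
lemma integral_restrictSphere_classicalCW_mul (J B : ℝ) {N a b c d : ℕ} (hab : a + b = N)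
    (hcd : c + d = N) :
    ∫ Ω, restrictSphere (classicalCW J B) Ω * coherentMonomial a b c d Ω ∂sphereMeasure =
      4 * (Real.pi : ℂ) *
        (-(J / 2 : ℂ) * (if d = b then
          (((a + 2).factorial * b.factorial - 2 * ((a + 1).factorial * (b + 1).factorial) +
            a.factorial * (b + 2).factorial) / (N + 3).factorial : ℂ) else 0) -
        B * ((if d + 1 = b then
            ((a + 1).factorial * b.factorial / (N + 2).factorial : ℂ) else 0) +
          (if d = b + 1 then
            (a.factorial * (b + 1).factorial / (N + 2).factorial : ℂ) else 0))) := by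
  have i1 := integrable_coherentMonomial (a + 2) b (c + 2) d
  have i2 := integrable_coherentMonomial (a + 1) (b + 1) (c + 1) (d + 1)
  have i3 := integrable_coherentMonomial a (b + 2) c (d + 2)
  have i4 := integrable_coherentMonomial (a + 1) b c (d + 1)
  have i5 := integrable_coherentMonomial a (b + 1) (c + 1) d
  have i12 : Integrable (fun Ω => coherentMonomial (a + 2) b (c + 2) d Ω -
      2 * coherentMonomial (a + 1) (b + 1) (c + 1) (d + 1) Ω) sphereMeasure :=
    i1.sub (i2.const_mul 2)
  have i123 : Integrable (fun Ω => coherentMonomial (a + 2) b (c + 2) d Ω -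
      2 * coherentMonomial (a + 1) (b + 1) (c + 1) (d + 1) Ω +
      coherentMonomial a (b + 2) c (d + 2) Ω) sphereMeasure := i12.add i3
  have i45 : Integrable (fun Ω => coherentMonomial (a + 1) b c (d + 1) Ω +
      coherentMonomial a (b + 1) (c + 1) d Ω) sphereMeasure := i4.add i5
  simp only [restrictSphere_classicalCW_mul_coherentMonomial]
  rw [integral_sub (i123.const_mul _) (i45.const_mul _), integral_const_mul,
    integral_const_mul, integral_add i4 i5, integral_add i12 i3, integral_sub i1 (i2.const_mul 2),
    integral_const_mul, integral_coherentMonomial (by omega),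
    integral_coherentMonomial (by omega), integral_coherentMonomial (by omega),
    integral_coherentMonomial (by omega), integral_coherentMonomial (by omega)]
  simp only [show a + 2 + b + 1 = N + 3 by omega, show a + 1 + (b + 1) + 1 = N + 3 by omega,
    show a + (b + 2) + 1 = N + 3 by omega, show a + 1 + b + 1 = N + 2 by omega,
    show a + (b + 1) + 1 = N + 2 by omega, add_left_inj, eq_comm (a := b), eq_comm (a := b + 1)]
  generalize (a + 2).factorial = a2, (a + 1).factorial = a1, a.factorial = a0,
    (b + 2).factorial = b2, (b + 1).factorial = b1, b.factorial = b0,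
    (N + 3).factorial = n3, (N + 2).factorial = n2
  split_ifs <;> ring

/-! ### Cancellation of binomial coefficients against factorials. -/

lemma choose_mul_factorial_eq (a b : ℕ) :
    ((a + b).choose b : ℂ) * (a.factorial * b.factorial) = (a + b).factorial := by
  have h := Nat.add_choose_mul_factorial_mul_factorial a b
  rw [mul_assoc] at h
  exact_mod_cast h

/-- The numerator comes from (a+2)(a+1) - 2(a+1)(b+1) + (b+2)(b+1) = (a-b)² + a + b + 2. Its part a
+ b + 2 produces the multiple 1/(N+3) of the identity. -/
lemma choose_mul_height_sq_coeff (a b : ℕ) :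
    ((a + b : ℕ) + 1 : ℂ) * ((((a + 2).factorial * b.factorial -
      2 * ((a + 1).factorial * (b + 1).factorial) + a.factorial * (b + 2).factorial) /
        (a + b + 3).factorial : ℂ) * (a + b).choose b) =
      (((a : ℂ) - b) ^ 2 + (a + b : ℕ) + 2) / (((a + b : ℕ) + 2) * ((a + b : ℕ) + 3)) := by
  have h := choose_mul_factorial_eq a b
  have h0 : ((a + b).factorial : ℂ) ≠ 0 := Nat.cast_ne_zero.2 (Nat.factorial_ne_zero _)
  have h1 : ((a + b : ℕ) + 1 : ℂ) ≠ 0 := by exact_mod_cast (by omega : a + b + 1 ≠ 0)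
  have h2 : ((a + b : ℕ) + 2 : ℂ) ≠ 0 := by exact_mod_cast (by omega : a + b + 2 ≠ 0)
  have h3 : ((a + b : ℕ) + 3 : ℂ) ≠ 0 := by exact_mod_cast (by omega : a + b + 3 ≠ 0)
  have f3 : ((a + b + 3).factorial : ℂ) =
      ((a + b : ℕ) + 3) * (((a + b : ℕ) + 2) * (((a + b : ℕ) + 1) * (a + b).factorial)) := by
    rw [Nat.factorial_succ, Nat.factorial_succ, Nat.factorial_succ]
    push_cast
    ring
  rw [f3, div_mul_eq_mul_div, mul_div_assoc', div_eq_div_iff (by positivity) (by positivity), ← h]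
  simp only [Nat.factorial_succ]
  push_cast
  ring

lemma choose_mul_ladder_coeff (a b : ℕ) :
    ((a + b : ℕ) + 1 : ℂ) * ((a.factorial * (b + 1).factorial / (a + b + 2).factorial : ℂ) *
      (a + b).choose b) = (b + 1) / ((a + b : ℕ) + 2) := by
  have h := choose_mul_factorial_eq a b
  have f2 : ((a + b + 2).factorial : ℂ) =
      ((a + b : ℕ) + 2) * (((a + b : ℕ) + 1) * (a + b).factorial) := by
    rw [Nat.factorial_succ, Nat.factorial_succ]
    push_cast
    ring
  have h0 : ((a + b).factorial : ℂ) ≠ 0 := Nat.cast_ne_zero.2 (Nat.factorial_ne_zero _)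
  have h1 : ((a + b : ℕ) + 1 : ℂ) ≠ 0 := by exact_mod_cast (by omega : a + b + 1 ≠ 0)
  have h2 : ((a + b : ℕ) + 2 : ℂ) ≠ 0 := by exact_mod_cast (by omega : a + b + 2 ≠ 0)
  rw [f2, div_mul_eq_mul_div, mul_div_assoc', div_eq_div_iff (by positivity) h2, ← h]
  simp only [Nat.factorial_succ]
  push_cast
  ring_nf

/-- The quantization of the classical Curie-Weiss Hamiltonian is an explicit spin operator. -/
lemma symIncl_sphereQuantization_classicalCW (J B : ℝ) (N : ℕ) (ψ : SymSpace N) :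
    symIncl N (sphereQuantization N (restrictSphere (classicalCW J B)) ψ) =
      (-(J / 2 : ℂ) / ((N + 2) * (N + 3))) •
          (∑ i : Fin N, ∑ j : Fin N, siteOp pauli3 i (siteOp pauli3 j (symIncl N ψ))) -
        (J / 2 / (N + 3) : ℂ) • symIncl N ψ -
        (B / (N + 2) : ℂ) • ∑ j : Fin N, siteOp pauli1 j (symIncl N ψ) := by
  obtain ⟨c, hc⟩ := exists_eq_comp_spinCount (symIncl_mem ψ)
  ext s
  have hs := spinCount_add s
  simp only [PiLp.sub_apply, PiLp.smul_apply, smul_eq_mul]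
  rw [symIncl_sphereQuantization_apply, sum_siteOp_pauli3_apply, sum_siteOp_pauli1_apply hc]
  simp only [integral_restrictSphere_classicalCW_mul J B hs (spinCount_add _), hc]
  generalize spinCount s 0 = a at *
  generalize spinCount s 1 = b at *
  have h1 (k : ℕ) (x : ℂ) : (∑ t : Fin N → Fin 2,
      (if spinCount t 1 = k then x else 0) * c (spinCount t 1)) = x * (N.choose k * c k) := by
    rw [← sum_ite_spinCount_eq, Finset.mul_sum]
    exact Finset.sum_congr rfl fun t _ => by split_ifs <;> simp
  have hdown (x : ℂ) : (∑ t : Fin N → Fin 2,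
      (if spinCount t 1 + 1 = b then x else 0) * c (spinCount t 1)) =
        if b = 0 then 0 else x * (N.choose (b - 1) * c (b - 1)) := by
    rcases b with _ | b
    · simp
    · simpa using h1 b x
  have hsplit (x y z : ℂ) : (∑ t : Fin N → Fin 2, 4 * (Real.pi : ℂ) *
      (-(J / 2 : ℂ) * (if spinCount t 1 = b then x else 0) -
        B * ((if spinCount t 1 + 1 = b then y else 0) +
          (if spinCount t 1 = b + 1 then z else 0))) * c (spinCount t 1)) =
      4 * Real.pi * (-(J / 2 : ℂ) * (x * (N.choose b * c b)) -
        B * ((if b = 0 then 0 else y * (N.choose (b - 1) * c (b - 1))) +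
          z * (N.choose (b + 1) * c (b + 1)))) := by
    rw [← h1, ← hdown, ← h1, ← Finset.sum_add_distrib, Finset.mul_sum, Finset.mul_sum,
      ← Finset.sum_sub_distrib, Finset.mul_sum]
    exact Finset.sum_congr rfl fun t _ => by ring
  rw [hsplit]
  have hπ : (Real.pi : ℂ) ≠ 0 := Complex.ofReal_ne_zero.2 Real.pi_ne_zero
  have hz := choose_mul_height_sq_coeff a b
  rw [hs] at hz
  have hd : ((N : ℂ) + 1) * (if b = 0 then 0 else
      ((a + 1).factorial * b.factorial / (N + 2).factorial : ℂ) *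
        (N.choose (b - 1) * c (b - 1))) = b / (N + 2) * c (b - 1) := by
    rcases b with _ | b
    · simp
    · have := choose_mul_ladder_coeff (a + 1) b
      rw [show a + 1 + b = N by omega] at this
      rw [if_neg b.succ_ne_zero, Nat.add_sub_cancel]
      push_cast
      linear_combination c b * this
  have hu : ((N : ℂ) + 1) * ((a.factorial * (b + 1).factorial / (N + 2).factorial : ℂ) *
        (N.choose (b + 1) * c (b + 1))) = a / (N + 2) * c (b + 1) := by
    rcases a with _ | a
    -- With no up spin left, b + 1 exceeds N and the binomial coefficient vanishes.
    · rw [Nat.choose_eq_zero_of_lt (by omega)]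
      simp
    -- The same ladder identity with up and down exchanged, through the symmetry of the binomial
    -- coefficient.
    · have := choose_mul_ladder_coeff (b + 1) a
      rw [show b + 1 + a = N by omega, Nat.choose_symm_of_eq_add (show N = a + (b + 1) by omega)]
        at this
      push_cast
      linear_combination c (b + 1) * this
  have h2 : (N : ℂ) + 2 ≠ 0 := by exact_mod_cast (by omega : N + 2 ≠ 0)
  have h3 : (N : ℂ) + 3 ≠ 0 := by exact_mod_cast (by omega : N + 3 ≠ 0)
  calc _ = -(J / 2 : ℂ) * c b * (((N : ℂ) + 1) * ((((a + 2).factorial * b.factorial -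
          2 * ((a + 1).factorial * (b + 1).factorial) + a.factorial * (b + 2).factorial) /
            (N + 3).factorial : ℂ) * N.choose b)) -
        B * (((N : ℂ) + 1) * (if b = 0 then 0 else
          ((a + 1).factorial * b.factorial / (N + 2).factorial : ℂ) *
            (N.choose (b - 1) * c (b - 1))) +
          ((N : ℂ) + 1) * ((a.factorial * (b + 1).factorial / (N + 2).factorial : ℂ) *
            (N.choose (b + 1) * c (b + 1)))) := by
        field_simp
    _ = _ := by
      rw [hz, hd, hu]
      field_simp
      ring


/-! ### Comparison of the two operators in norm. -/

lemma symIncl_quantumCWSym_sub_sphereQuantization (J B : ℝ) {N : ℕ} (hN : N ≠ 0)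
    (ψ : SymSpace N) :
    symIncl N ((quantumCWSym J B N - sphereQuantization N (restrictSphere (classicalCW J B))) ψ) =
      (-(J / 2 : ℂ) * (1 / N ^ 2 - 1 / ((N + 2) * (N + 3)))) •
          (∑ i : Fin N, ∑ j : Fin N, siteOp pauli3 i (siteOp pauli3 j (symIncl N ψ))) +
        (J / 2 / (N + 3) : ℂ) • symIncl N ψ -
        (B * (1 / N - 1 / (N + 2)) : ℂ) • ∑ j : Fin N, siteOp pauli1 j (symIncl N ψ) := by
  rw [sub_apply, map_sub, symIncl_sphereQuantization_classicalCW,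
    symIncl_quantumCWSym]
  have e : quantumCW J B N (symIncl N ψ) = (1 / (N : ℂ)) •
    ((-((J : ℂ) / (2 * (N : ℂ)))) •
      (∑ i : Fin N, ∑ j : Fin N, siteOp pauli3 i (siteOp pauli3 j (symIncl N ψ)))
      - (B : ℂ) • ∑ j : Fin N, siteOp pauli1 j (symIncl N ψ)) := by
    simp [quantumCW]
  rw [e]
  have h0 : (N : ℂ) ≠ 0 := Nat.cast_ne_zero.2 hN
  have h2 : (N : ℂ) + 2 ≠ 0 := by exact_mod_cast (by omega : N + 2 ≠ 0)
  have h3 : (N : ℂ) + 3 ≠ 0 := by exact_mod_cast (by omega : N + 3 ≠ 0)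
  match_scalars <;> field_simp <;> ring

/-- The coefficient differences are of order N⁻³, N⁻¹ and N⁻², against operators of norm at most N²,
1 and N. The constant 3 is (5 + 1)/2, from the S₃² and identity terms. -/
lemma norm_quantumCWSym_sub_sphereQuantization_le (J B : ℝ) {N : ℕ} (hN : N ≠ 0) :
    ‖quantumCWSym J B N - sphereQuantization N (restrictSphere (classicalCW J B))‖ ≤
      (3 * |J| + 2 * |B|) / N := by
  have hN0 : (0 : ℝ) < N := Nat.cast_pos.2 (Nat.pos_of_ne_zero hN)
  refine ContinuousLinearMap.opNorm_le_bound _ (by positivity) fun ψ => ?_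
  have h3 : ‖∑ i : Fin N, ∑ j : Fin N, siteOp pauli3 i (siteOp pauli3 j (symIncl N ψ))‖ ≤
      N ^ 2 * ‖ψ‖ := by
    refine (norm_sum_le_of_le _ fun i _ => norm_sum_le _ _).trans_eq ?_
    simp [norm_siteOp_pauli3]
    ring
  have h1 : ‖∑ j : Fin N, siteOp pauli1 j (symIncl N ψ)‖ ≤ N * ‖ψ‖ := by
    refine (norm_sum_le _ _).trans_eq ?_
    simp [norm_siteOp_pauli1]
  rw [← (symIncl N).norm_map, symIncl_quantumCWSym_sub_sphereQuantization J B hN]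
  refine (norm_sub_le _ _).trans ((add_le_add_left (norm_add_le _ _) _).trans ?_)
  rw [norm_smul, norm_smul, norm_smul, (symIncl N).norm_map]
  have hα : (0 : ℝ) ≤ 1 / N ^ 2 - 1 / ((N + 2) * (N + 3)) := by
    rw [sub_nonneg]
    exact one_div_le_one_div_of_le (by positivity) (by nlinarith)
  have hγ : (0 : ℝ) ≤ 1 / N - 1 / (N + 2) := by
    rw [sub_nonneg]
    exact one_div_le_one_div_of_le (by positivity) (by linarith)
  have eα : ‖-(J / 2 : ℂ) * (1 / N ^ 2 - 1 / ((N + 2) * (N + 3)))‖ =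
      |J| / 2 * (1 / N ^ 2 - 1 / ((N + 2) * (N + 3))) := by
    rw [show -(J / 2 : ℂ) * (1 / N ^ 2 - 1 / ((N + 2) * (N + 3))) =
      ((-(J / 2) * (1 / N ^ 2 - 1 / ((N + 2) * (N + 3))) : ℝ) : ℂ) by push_cast; ring,
      Complex.norm_real, Real.norm_eq_abs, abs_mul, abs_of_nonneg hα, abs_neg, abs_div, abs_two]
  have eβ : ‖(J / 2 / (N + 3) : ℂ)‖ = |J| / 2 / (N + 3) := by
    rw [show (J / 2 / (N + 3) : ℂ) = ((J / 2 / (N + 3) : ℝ) : ℂ) by push_cast; ring,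
      Complex.norm_real, Real.norm_eq_abs, abs_div, abs_div, abs_two,
      abs_of_pos (by positivity : (0 : ℝ) < N + 3)]
  have eγ : ‖(B * (1 / N - 1 / (N + 2)) : ℂ)‖ = |B| * (1 / N - 1 / (N + 2)) := by
    rw [show (B * (1 / N - 1 / (N + 2)) : ℂ) = ((B * (1 / N - 1 / (N + 2)) : ℝ) : ℂ) by
      push_cast; ring, Complex.norm_real, Real.norm_eq_abs, abs_mul, abs_of_nonneg hγ]
  rw [eα, eβ, eγ]
  -- The 5 is the linear coefficient in (N+2)(N+3) - N² = 5N + 6.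
  have bα : (1 / N ^ 2 - 1 / ((N + 2) * (N + 3)) : ℝ) * N ^ 2 ≤ 5 / N := by
    rw [show (1 / N ^ 2 - 1 / ((N + 2) * (N + 3)) : ℝ) * N ^ 2 =
      (5 * N + 6) / ((N + 2) * (N + 3)) by field_simp; ring, div_le_div_iff₀ (by positivity) hN0]
    nlinarith
  have bβ : (1 / (N + 3) : ℝ) ≤ 1 / N := one_div_le_one_div_of_le hN0 (by linarith)
  have bγ : (1 / N - 1 / (N + 2) : ℝ) * N ≤ 2 / N := by
    rw [show (1 / N - 1 / (N + 2) : ℝ) * N = 2 / (N + 2) by field_simp; ring]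
    exact div_le_div_of_nonneg_left two_pos.le hN0 (by linarith)
  calc _ ≤ |J| / 2 * (1 / N ^ 2 - 1 / ((N + 2) * (N + 3))) * (N ^ 2 * ‖ψ‖) +
        |J| / 2 / (N + 3) * ‖ψ‖ + |B| * (1 / N - 1 / (N + 2)) * (N * ‖ψ‖) := by gcongr
    _ = (|J| / 2 * ((1 / N ^ 2 - 1 / ((N + 2) * (N + 3))) * N ^ 2) + |J| / 2 * (1 / (N + 3)) +
        |B| * ((1 / N - 1 / (N + 2)) * N)) * ‖ψ‖ := by ring
    _ ≤ (|J| / 2 * (5 / N) + |J| / 2 * (1 / N) + |B| * (2 / N)) * ‖ψ‖ := by gcongr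
    _ = (3 * |J| + 2 * |B|) / N * ‖ψ‖ := by ring

end CurieWeiss

end

theorem theorem3p1 (J B : ℝ) :
    Tendsto
      (fun N : ℕ =>
        ‖CurieWeiss.quantumCWSym J B N -
          CurieWeiss.sphereQuantization N
            (CurieWeiss.restrictSphere (CurieWeiss.classicalCW J B))‖)
      atTop (𝓝 0) := by
  refine squeeze_zero' (Eventually.of_forall fun N => norm_nonneg _) ?_
    (tendsto_const_div_atTop_nhds_zero_nat (3 * |J| + 2 * |B|))
  filter_upwards [eventually_ne_atTop 0] with N hN
  exact CurieWeiss.norm_quantumCWSym_sub_sphereQuantization_le J B hN
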